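/- Let $\Gamma$ be a countable group. A unitary representation of $\Gamma$ is a homomorphism $\pi:\Gamma\to U(\mathcal H_\pi)$ into the unitary group of a complex Hilbert space. Put $\operatorname{Fix}(\pi)=\{\zeta\in\mathcal H_\pi:\pi(\gamma)\zeta=\zeta\ \text{for all }\gamma\in\Gamma\}$ and $\operatorname{Erg}(\pi)=\operatorname{Fix}(\pi)^\perp$. Say that $\pi$ has spectral gap if there are a finite $F\subseteq\Gamma$ and $c>0$ such that every $\zeta\in\operatorname{Erg}(\pi)$ satisfies $\|\pi(\gamma)\zeta-\zeta\|\ge c\|\zeta\|$ for some $\gamma\in F$. The group $\Gamma$ has property (T) if every unitary representation of $\Gamma$ has spectral gap. A pair $(F,\delta)$ with $F\subseteq\Gamma$ finite and $\delta>0$ is a Kazhdan pair if every unitary representation $\pi$ for which there is $\xi\neq0$ with $\|\pi(\gamma)\xi-\xi\|<\delta\|\xi\|$ for all $\gamma\in F$ has $\operatorname{Fix}(\pi)\ne\{0\}$. View the closed unit ball of a unitary representation of $\Gamma$ as a metric structure, in the sense of continuous logic, in the one-sorted language of unit balls of complex Hilbert spaces (with symbols for $0$, for $(x,y)\mapsto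 ax+by$ with $|a|+|b|\le1$, and for the real and imaginary parts of the inner product) augmented by a unary function symbol for each $\gamma\in\Gamma$. Let $T_\Gamma$ be the theory of the class of these structures, that is, the set of all sentences that have value $0$ in all of them. A simple $T_\Gamma$-formula is a formula of this language (up to $T_\Gamma$-equivalence), and a $T_\Gamma$-formula is an element of the completion of the space of formulae $\varphi(\vec x)$ for the pseudometric $d(\varphi,\psi)=\sup\{|\varphi^{\mathbf M}(\vec a)-\psi^{\mathbf M}(\vec a)|:\mathbf M\models T_\Gamma,\ \vec a\in\mathbf M^{\vec x}\}$. A nonnegative $T_\Gamma$-formula $\varphi$ is almost-near if for every $\epsilon>0$ there is $\delta>0$ such that for all $\mathbf M\models T_\Gamma$ and all $\vec a\in\mathbf M^{\vec x}$ with $\varphi^{\mathbf M}(\vec a)<\delta$ there is $\vec b\in\mathbf M^{\vec x}$ with $d(\vec a,\vec b)\le\epsilon$ and $\varphi^{\mathbf M}(\vec b)=0$. A $T_\Gamma$-functor $X$ is an assignment to each $\mathbf M\models T_\Gamma$ of a closed set $X(\mathbf M)\subseteq\mathbf M^{\vec x}$ that is functorial, by restriction, for elementary embeddings. It is a $T_\Gamma$-definable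 set, witnessed by $\varphi$, if $\varphi$ is an almost-near $T_\Gamma$-formula with $X(\mathbf M)=\{\vec a:\varphi^{\mathbf M}(\vec a)=0\}$ for all $\mathbf M\models T_\Gamma$. Let $\operatorname{Fix}$ be the $T_\Gamma$-functor $\mathbf M\mapsto\{a\in\mathbf M:\gamma\cdot a=a\ \text{for all }\gamma\in\Gamma\}$. **Theorem.** The following are equivalent: 1. $\Gamma$ has property (T). 2. The $T_\Gamma$-functor $\operatorname{Fix}$ is a $T_\Gamma$-definable set. In this case, a simple $T_\Gamma$-formula witnesses that $\operatorname{Fix}$ is a definable set: a Kazhdan pair for $\Gamma$ exists and, for every Kazhdan pair $(F,\delta)$, the simple $T_\Gamma$-formula $\max_{\gamma\in F}d(\gamma\cdot x,x)$ is almost-near with zeroset $\operatorname{Fix}$. Moreover the distance function $(\mathbf M,a)\mapsto d(a,\operatorname{Fix}(\mathbf M))$ is then realized by a simple $T_\Gamma$-formula. -/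

import Mathlib

universe u v w

noncomputable section

namespace ContLogic

open Filter Topology

/-! ## Continuous logic for one-sorted bounded metric structures -/

/-- A (one-sorted) metric signature. It provides a bound on the diameter of the sort, function and
relation symbols with arities, a modulus of uniform continuity for each symbol, and a compact
interval of values for each relation symbol. -/
structure MetricSignature where
  diam : ℝ
  Func : ℕ → Type v
  Rel : ℕ → Type w
  funcModulus : ∀ {k : ℕ}, Func k → ℝ → ℝ
  funcModulus_pos : ∀ {k : ℕ} (f : Func k) (ε : ℝ), 0 < ε → 0 < funcModulus f ε
  relModulus : ∀ {k : ℕ}, Rel k → ℝ → ℝ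
  relModulus_pos : ∀ {k : ℕ} (R : Rel k) (ε : ℝ), 0 < ε → 0 < relModulus R ε
  relLower : ∀ {k : ℕ}, Rel k → ℝ
  relUpper : ∀ {k : ℕ}, Rel k → ℝ

/-- An `L`-structure: a nonempty complete metric space of diameter at most the prescribed bound,
with interpretations of the symbols that respect the prescribed moduli and intervals. Finite powers
`Fin k → M` carry the maximum metric. -/
structure MetricStructure (L : MetricSignature.{v, w}) where
  Carrier : Type u
  [metric : MetricSpace Carrier]
  [complete : CompleteSpace Carrier]
  [nonempty : Nonempty Carrier]
  dist_le_diam : ∀ x y : Carrier, dist x y ≤ L.diam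
  func : ∀ {k : ℕ}, L.Func k → (Fin k → Carrier) → Carrier
  rel : ∀ {k : ℕ}, L.Rel k → (Fin k → Carrier) → ℝ
  func_modulus : ∀ {k : ℕ} (f : L.Func k) (ε : ℝ), 0 < ε → ∀ x y : Fin k → Carrier,
    dist x y < L.funcModulus f ε → dist (func f x) (func f y) ≤ ε
  rel_mem : ∀ {k : ℕ} (R : L.Rel k) (x : Fin k → Carrier),
    rel R x ∈ Set.Icc (L.relLower R) (L.relUpper R)
  rel_modulus : ∀ {k : ℕ} (R : L.Rel k) (ε : ℝ), 0 < ε → ∀ x y : Fin k → Carrier,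
    dist x y < L.relModulus R ε → |rel R x - rel R y| ≤ ε

attribute [instance] MetricStructure.metric MetricStructure.complete MetricStructure.nonempty

/-- `L`-terms in the variables `x₀, …, xₙ₋₁`. -/
inductive Term (L : MetricSignature.{v, w}) (n : ℕ) : Type v
  | var (i : Fin n) : Term L n
  | func {k : ℕ} (f : L.Func k) (t : Fin k → Term L n) : Term L n

/-- `L`-formulae with free variables among `x₀, …, xₙ₋₁`: atomic formulae, closed under all
continuous connectives `ℝᵏ → ℝ` and the quantifiers `sup` and `inf` (which bind the last
variable). -/
inductive Formula (L : MetricSignature.{v, w}) : ℕ → Type (max v w)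
  | rel {n k : ℕ} (R : L.Rel k) (t : Fin k → Term L n) : Formula L n
  | dist {n : ℕ} (s t : Term L n) : Formula L n
  | conn {n k : ℕ} (c : C(Fin k → ℝ, ℝ)) (φ : Fin k → Formula L n) : Formula L n
  | sup {n : ℕ} (φ : Formula L (n + 1)) : Formula L n
  | inf {n : ℕ} (φ : Formula L (n + 1)) : Formula L n

variable {L : MetricSignature.{v, w}}

/-- Value of a term at a tuple. -/
def Term.eval (M : MetricStructure.{u} L) {n : ℕ} (a : Fin n → M.Carrier) :
    Term L n → M.Carrier
  | .var i => a i
  | .func f t => M.func f (fun i => (t i).eval M a)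

/-- The interpretation `φ^M : Mⁿ → ℝ` of a formula. -/
def Formula.interp (M : MetricStructure.{u} L) :
    ∀ {n : ℕ}, Formula L n → (Fin n → M.Carrier) → ℝ
  | _, .rel R t, a => M.rel R (fun i => (t i).eval M a)
  | _, .dist s t, a => Dist.dist (s.eval M a) (t.eval M a)
  | _, .conn c φ, a => c (fun i => (φ i).interp M a)
  | _, .sup φ, a => ⨆ b : M.Carrier, φ.interp M (Fin.snoc a b)
  | _, .inf φ, a => ⨅ b : M.Carrier, φ.interp M (Fin.snoc a b)

/-- An `L`-theory is a set of `L`-sentences. -/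
abbrev Theory (L : MetricSignature.{v, w}) := Set (Formula L 0)

/-- `M ⊨ T`: every sentence of `T` takes the value `0` in `M`. -/
def Models (M : MetricStructure.{u} L) (T : Theory L) : Prop :=
  ∀ σ ∈ T, σ.interp M ![] = 0

/-- The class `Mod(T)`. -/
structure Model (T : Theory L) where
  str : MetricStructure.{u} L
  models : Models str T

/-- The underlying space of a model. -/
abbrev Model.Carrier {T : Theory L} (M : Model.{u} T) : Type u := M.str.Carrier

/-- Elementary embeddings between structures: maps preserving the value of every formula. -/
structure ElementaryEmbedding (M N : MetricStructure.{u} L) where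
  toFun : M.Carrier → N.Carrier
  map_formula : ∀ {n : ℕ} (φ : Formula L n) (a : Fin n → M.Carrier),
    φ.interp N (fun i => toFun (a i)) = φ.interp M a

/-! ### `T`-formulae: the completion of the space of formulae -/

/-- Sequences of formulae that are Cauchy for the pseudometric
`d(φ, ψ) = sup {|φ^M(a) - ψ^M(a)| : M ⊨ T, a ∈ Mⁿ}`. -/
def CauchySeqFormula (T : Theory L) (n : ℕ) :=
  {s : ℕ → Formula L n // ∀ ε : ℝ, 0 < ε → ∃ N : ℕ, ∀ i ≥ N, ∀ j ≥ N,
    ∀ (M : Model.{u} T) (a : Fin n → M.Carrier),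
      |(s i).interp M.str a - (s j).interp M.str a| ≤ ε}

/-- Two Cauchy sequences are identified when `d(φᵢ, ψᵢ) → 0`. -/
instance formulaSetoid (T : Theory L) (n : ℕ) : Setoid (CauchySeqFormula.{u} T n) where
  r s t := ∀ ε : ℝ, 0 < ε → ∃ N : ℕ, ∀ i ≥ N, ∀ (M : Model.{u} T) (a : Fin n → M.Carrier),
    |(s.1 i).interp M.str a - (t.1 i).interp M.str a| ≤ ε
  iseqv :=
    { refl := fun s ε hε => ⟨0, fun i _ M a => by simpa using hε.le⟩
      symm := fun {s t} h ε hε => by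
        obtain ⟨N, hN⟩ := h ε hε
        exact ⟨N, fun i hi M a => by rw [abs_sub_comm]; exact hN i hi M a⟩
      trans := fun {s t r} h₁ h₂ ε hε => by
        obtain ⟨N₁, h₁⟩ := h₁ (ε / 2) (half_pos hε)
        obtain ⟨N₂, h₂⟩ := h₂ (ε / 2) (half_pos hε)
        refine ⟨max N₁ N₂, fun i hi M a => ?_⟩
        have e₁ := h₁ i (le_trans (le_max_left _ _) hi) M a
        have e₂ := h₂ i (le_trans (le_max_right _ _) hi) M a
        have := abs_sub_le ((s.1 i).interp M.str a) ((t.1 i).interp M.str a)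
          ((r.1 i).interp M.str a)
        linarith }

/-- A `T`-formula over `n` variables: an element of the completion of the space of formulae. -/
def TFormula (T : Theory L) (n : ℕ) := Quotient (formulaSetoid.{u} T n)

theorem CauchySeqFormula.tendsto {T : Theory L} {n : ℕ} (s : CauchySeqFormula.{u} T n)
    (M : Model.{u} T) (a : Fin n → M.Carrier) :
    ∃ x : ℝ, Tendsto (fun i => (s.1 i).interp M.str a) atTop (𝓝 x) := by
  apply cauchySeq_tendsto_of_complete
  rw [Metric.cauchySeq_iff]
  intro ε hε
  obtain ⟨N, hN⟩ := s.2 (ε / 2) (half_pos hε)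
  refine ⟨N, fun i hi j hj => ?_⟩
  rw [Real.dist_eq]
  exact lt_of_le_of_lt (hN i hi j hj M a) (half_lt_self hε)

/-- The interpretation of a `T`-formula in a model of `T`: the limit of the interpretations along
any representing Cauchy sequence. -/
def TFormula.interp {T : Theory L} {n : ℕ} (φ : TFormula.{u} T n) (M : Model.{u} T)
    (a : Fin n → M.Carrier) : ℝ :=
  Quotient.lift (s := formulaSetoid.{u} T n)
    (fun s : CauchySeqFormula.{u} T n => limUnder atTop (fun i => (s.1 i).interp M.str a))
    (by
      intro s t h
      obtain ⟨x, hx⟩ := s.tendsto M a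
      obtain ⟨y, hy⟩ := t.tendsto M a
      have hz : Tendsto (fun i => (s.1 i).interp M.str a - (t.1 i).interp M.str a)
          atTop (𝓝 0) := by
        rw [Metric.tendsto_atTop]
        intro ε hε
        obtain ⟨N, hN⟩ := h (ε / 2) (half_pos hε)
        refine ⟨N, fun i hi => ?_⟩
        rw [Real.dist_eq, sub_zero]
        exact lt_of_le_of_lt (hN i hi M a) (half_lt_self hε)
      have hxy : x - y = 0 := tendsto_nhds_unique (hx.sub hy) hz
      change limUnder atTop _ = limUnder atTop _
      rw [hx.limUnder_eq, hy.limUnder_eq]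
      linarith) φ

/-- A formula viewed as a `T`-formula (a simple `T`-formula): the class of the constant sequence. -/
def Formula.toTFormula (T : Theory L) {n : ℕ} (φ : Formula L n) : TFormula.{u} T n :=
  Quotient.mk (formulaSetoid.{u} T n)
    ⟨fun _ => φ, fun ε hε => ⟨0, fun i _ j _ M a => by simpa using hε.le⟩⟩

/-- A `T`-formula is simple if it is (the class of) a single, finitary formula. -/
def TFormula.IsSimple {T : Theory L} {n : ℕ} (φ : TFormula.{u} T n) : Prop :=
  ∃ ψ : Formula L n, φ = ψ.toTFormula T

/-- A `T`-formula is nonnegative if all its values are. -/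
def TFormula.Nonneg {T : Theory L} {n : ℕ} (φ : TFormula.{u} T n) : Prop :=
  ∀ (M : Model.{u} T) (a : Fin n → M.Carrier), 0 ≤ φ.interp M a

/-- The zeroset of a `T`-formula. -/
def TFormula.zeroset {T : Theory L} {n : ℕ} (φ : TFormula.{u} T n) (M : Model.{u} T) :
    Set (Fin n → M.Carrier) :=
  {a | φ.interp M a = 0}

/-- A nonnegative `T`-formula is almost-near if, uniformly over all models of `T`, points where it
is small are close to points where it vanishes. -/
def TFormula.AlmostNear {T : Theory L} {n : ℕ} (φ : TFormula.{u} T n) : Prop :=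
  φ.Nonneg ∧ ∀ ε : ℝ, 0 < ε → ∃ δ : ℝ, 0 < δ ∧
    ∀ (M : Model.{u} T) (a : Fin n → M.Carrier), φ.interp M a < δ →
      ∃ b : Fin n → M.Carrier, dist a b ≤ ε ∧ φ.interp M b = 0

/-! ### `T`-functors and `T`-definable sets -/

/-- A `T`-functor over `n` variables: an assignment of a closed subset `X(M) ⊆ Mⁿ` to each model
`M` of `T` which is functorial, by restriction, for elementary embeddings. -/
structure TFunctor (T : Theory L) (n : ℕ) where
  obj : ∀ M : Model.{u} T, Set (Fin n → M.Carrier)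
  isClosed_obj : ∀ M : Model.{u} T, IsClosed (obj M)
  map_mem : ∀ (M N : Model.{u} T) (j : ElementaryEmbedding M.str N.str),
    ∀ a ∈ obj M, (fun i => j.toFun (a i)) ∈ obj N

/-- The `T`-formula `φ` witnesses that the `T`-functor `X` is a `T`-definable set: it is almost-near
and its zeroset is `X`. -/
def TFunctor.IsWitness {T : Theory L} {n : ℕ} (X : TFunctor.{u} T n) (φ : TFormula.{u} T n) :
    Prop :=
  φ.AlmostNear ∧ ∀ M : Model.{u} T, X.obj M = φ.zeroset M

/-- A `T`-functor is a `T`-definable set if it is the zeroset of an almost-near `T`-formula. -/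
def TFunctor.IsDefinable {T : Theory L} {n : ℕ} (X : TFunctor.{u} T n) : Prop :=
  ∃ φ : TFormula.{u} T n, X.IsWitness φ

end ContLogic

namespace UnitaryRep

/-! ## Unitary representations, spectral gap, property (T) -/

section

variable {Γ : Type v} [Group Γ] {H : Type u} [NormedAddCommGroup H] [InnerProductSpace ℂ H]
  [CompleteSpace H]

/-- The subspace `Fix(π)` of invariant vectors of a unitary representation. -/
def Fix (π : Γ →* unitary (H →L[ℂ] H)) : Submodule ℂ H where
  carrier := {ξ | ∀ γ : Γ, (π γ : H →L[ℂ] H) ξ = ξ}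
  zero_mem' := fun γ => map_zero _
  add_mem' := fun {x y} hx hy γ => by rw [map_add, hx γ, hy γ]
  smul_mem' := fun c x hx γ => by rw [map_smul, hx γ]

/-- The ergodic part `Erg(π) = Fix(π)ᗮ`. -/
def Erg (π : Γ →* unitary (H →L[ℂ] H)) : Submodule ℂ H := (Fix π)ᗮ

/-- `π` is ergodic if it has no nonzero invariant vector. -/
def IsErgodic (π : Γ →* unitary (H →L[ℂ] H)) : Prop := Fix π = ⊥

/-- `π` has spectral gap: for some finite `F ⊆ Γ` and `c > 0`, every `ζ ∈ Erg(π)` satisfies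
`max_{γ ∈ F} ‖π(γ)ζ - ζ‖ ≥ c‖ζ‖`. -/
def HasSpectralGap (π : Γ →* unitary (H →L[ℂ] H)) : Prop :=
  ∃ (F : Finset Γ) (c : ℝ), 0 < c ∧
    ∀ ζ ∈ Erg π, ∃ γ ∈ F, c * ‖ζ‖ ≤ ‖(π γ : H →L[ℂ] H) ζ - ζ‖

/-- `ξ` is `(F, δ)`-almost invariant: `max_{γ ∈ F} ‖π(γ)ξ - ξ‖ < δ‖ξ‖`. (For nonempty `F` the
condition `ξ ≠ 0` is automatic.) -/
def IsAlmostInvariant (π : Γ →* unitary (H →L[ℂ] H)) (F : Finset Γ) (δ : ℝ) (ξ : H) : Prop :=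
  ξ ≠ 0 ∧ ∀ γ ∈ F, ‖(π γ : H →L[ℂ] H) ξ - ξ‖ < δ * ‖ξ‖

end

/-- `Γ` has property (T): every unitary representation of `Γ` has spectral gap. -/
def PropertyT (Γ : Type v) [Group Γ] : Prop :=
  ∀ (H : Type u) [NormedAddCommGroup H] [InnerProductSpace ℂ H] [CompleteSpace H]
    (π : Γ →* unitary (H →L[ℂ] H)), HasSpectralGap π

/-- `(F, δ)` is a Kazhdan pair for `Γ`: `δ > 0`, and every unitary representation of `Γ` with an
`(F, δ)`-almost invariant vector has a nonzero invariant vector. -/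
def IsKazhdanPair (Γ : Type v) [Group Γ] (F : Finset Γ) (δ : ℝ) : Prop :=
  0 < δ ∧ ∀ (H : Type u) [NormedAddCommGroup H] [InnerProductSpace ℂ H] [CompleteSpace H]
    (π : Γ →* unitary (H →L[ℂ] H)), (∃ ξ : H, IsAlmostInvariant π F δ ξ) → ¬ IsErgodic π

/-! ## Unitary representations as metric structures -/

open ContLogic

/-- Function symbols: the zero vector, the combinations `(x, y) ↦ a • x + b • y` that preserve unit
balls, and the elements of `Γ`. -/
inductive RepFunc (Γ : Type v) : ℕ → Type v
  | zero : RepFunc Γ 0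
  | comb (a b : ℂ) (h : ‖a‖ + ‖b‖ ≤ 1) : RepFunc Γ 2
  | act (γ : Γ) : RepFunc Γ 1

/-- Relation symbols: real and imaginary part of the inner product. -/
inductive RepRel : ℕ → Type
  | innerRe : RepRel 2
  | innerIm : RepRel 2

/-- The language of unit balls of complex Hilbert spaces with function symbols for elements of
`Γ`. -/
def repSignature (Γ : Type v) : MetricSignature.{v, 0} where
  diam := 2
  Func := RepFunc Γ
  Rel := RepRel
  funcModulus := fun _ ε => ε
  funcModulus_pos := fun _ _ hε => hε
  relModulus := fun _ ε => ε / 2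
  relModulus_pos := fun _ _ hε => half_pos hε
  relLower := fun _ => -1
  relUpper := fun _ => 1

section

variable {Γ : Type v} [Group Γ] {H : Type u} [NormedAddCommGroup H] [InnerProductSpace ℂ H]
  [CompleteSpace H]

theorem norm_act (π : Γ →* unitary (H →L[ℂ] H)) (γ : Γ) (x : H) :
    ‖(π γ : H →L[ℂ] H) x‖ = ‖x‖ :=
  ContinuousLinearMap.norm_map_of_mem_unitary (π γ).2 x

theorem norm_comb_le {a b : ℂ} (h : ‖a‖ + ‖b‖ ≤ 1) {x y : H} {r : ℝ} (hx : ‖x‖ ≤ r)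
    (hy : ‖y‖ ≤ r) : ‖a • x + b • y‖ ≤ r := by
  have hr : 0 ≤ r := (norm_nonneg x).trans hx
  calc ‖a • x + b • y‖ ≤ ‖a‖ * ‖x‖ + ‖b‖ * ‖y‖ := by
        simpa only [norm_smul] using norm_add_le (a • x) (b • y)
    _ ≤ ‖a‖ * r + ‖b‖ * r := by gcongr
    _ = (‖a‖ + ‖b‖) * r := by ring
    _ ≤ r := by nlinarith

/-- Interpretation of the function symbols in the unit ball of `H`. -/
def ballFunc (π : Γ →* unitary (H →L[ℂ] H)) :
    ∀ {k : ℕ}, RepFunc Γ k → (Fin k → Metric.closedBall (0 : H) 1) → Metric.closedBall (0 : H) 1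
  | _, .zero, _ => ⟨0, by simp⟩
  | _, .comb a b h, x => ⟨a • (x 0 : H) + b • (x 1 : H), mem_closedBall_zero_iff.2
      (norm_comb_le h (mem_closedBall_zero_iff.1 (x 0).2) (mem_closedBall_zero_iff.1 (x 1).2))⟩
  | _, .act γ, x => ⟨(π γ : H →L[ℂ] H) (x 0 : H), mem_closedBall_zero_iff.2
      ((norm_act π γ _).trans_le (mem_closedBall_zero_iff.1 (x 0).2))⟩

/-- Interpretation of the relation symbols in the unit ball of `H`. -/
def ballRel (H : Type u) [NormedAddCommGroup H] [InnerProductSpace ℂ H] :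
    ∀ {k : ℕ}, RepRel k → (Fin k → Metric.closedBall (0 : H) 1) → ℝ
  | _, .innerRe, x => (inner ℂ (x 0 : H) (x 1 : H)).re
  | _, .innerIm, x => (inner ℂ (x 0 : H) (x 1 : H)).im

theorem norm_inner_sub_le (x y x' y' : H) (hy : ‖y‖ ≤ 1) (hx' : ‖x'‖ ≤ 1) {r : ℝ}
    (hx : ‖x - x'‖ ≤ r) (hyy : ‖y - y'‖ ≤ r) :
    ‖inner ℂ x y - inner ℂ x' y'‖ ≤ 2 * r := by
  have h : inner ℂ x y - inner ℂ x' y' = inner ℂ (x - x') y + inner ℂ x' (y - y') := by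
    rw [inner_sub_left, inner_sub_right]; ring
  have h₁ := norm_inner_le_norm (𝕜 := ℂ) (x - x') y
  have h₂ := norm_inner_le_norm (𝕜 := ℂ) x' (y - y')
  rw [h]
  refine (norm_add_le _ _).trans ?_
  nlinarith [norm_nonneg y, norm_nonneg x', norm_nonneg (x - x'), norm_nonneg (y - y')]

/-- The unit ball of a unitary representation, as a metric structure. -/
def ballStructure (π : Γ →* unitary (H →L[ℂ] H)) : MetricStructure.{u} (repSignature Γ) where
  Carrier := Metric.closedBall (0 : H) 1
  complete := Metric.isClosed_closedBall.completeSpace_coe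
  nonempty := ⟨⟨0, by simp⟩⟩
  dist_le_diam := fun x y => by
    have hx := mem_closedBall_zero_iff.1 x.2
    have hy := mem_closedBall_zero_iff.1 y.2
    have := norm_sub_le (x : H) (y : H)
    rw [Subtype.dist_eq, dist_eq_norm]
    change _ ≤ (2 : ℝ)
    linarith
  func := fun f x => ballFunc π f x
  rel := fun R x => ballRel H R x
  func_modulus := by
    intro k f ε hε x y hxy
    change dist x y < ε at hxy
    have hc : ∀ i, ‖((x i : H) - (y i : H))‖ ≤ ε := fun i => by
      rw [← dist_eq_norm, ← Subtype.dist_eq]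
      exact (dist_le_pi_dist x y i).trans hxy.le
    cases f with
    | zero => rw [show ballFunc π RepFunc.zero x = ballFunc π RepFunc.zero y from rfl, dist_self]
              exact hε.le
    | comb a b h =>
      rw [Subtype.dist_eq, dist_eq_norm]
      change ‖(a • (x 0 : H) + b • (x 1 : H)) - (a • (y 0 : H) + b • (y 1 : H))‖ ≤ ε
      rw [add_sub_add_comm, ← smul_sub, ← smul_sub]
      exact norm_comb_le h (hc 0) (hc 1)
    | act γ =>
      rw [Subtype.dist_eq, dist_eq_norm]
      change ‖(π γ : H →L[ℂ] H) (x 0 : H) - (π γ : H →L[ℂ] H) (y 0 : H)‖ ≤ ε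
      rw [← map_sub, norm_act]
      exact hc 0
  rel_mem := by
    intro k R x
    have hn : ∀ i j, ‖inner ℂ (x i : H) (x j : H)‖ ≤ 1 := fun i j => by
      have hi := mem_closedBall_zero_iff.1 (x i).2
      have hj := mem_closedBall_zero_iff.1 (x j).2
      have := norm_inner_le_norm (𝕜 := ℂ) (x i : H) (x j : H)
      nlinarith [norm_nonneg (x i : H), norm_nonneg (x j : H)]
    cases R with
    | innerRe => exact abs_le.1 ((Complex.abs_re_le_norm _).trans (hn 0 1))
    | innerIm => exact abs_le.1 ((Complex.abs_im_le_norm _).trans (hn 0 1))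
  rel_modulus := by
    intro k R ε hε x y hxy
    change dist x y < ε / 2 at hxy
    have hc : ∀ i, ‖((x i : H) - (y i : H))‖ ≤ ε / 2 := fun i => by
      rw [← dist_eq_norm, ← Subtype.dist_eq]
      exact (dist_le_pi_dist x y i).trans hxy.le
    have hn : ∀ i j, ‖inner ℂ (x i : H) (x j : H) - inner ℂ (y i : H) (y j : H)‖ ≤ ε :=
      fun i j => by
        have := norm_inner_sub_le (x i : H) (x j : H) (y i : H) (y j : H)
          (mem_closedBall_zero_iff.1 (x j).2) (mem_closedBall_zero_iff.1 (y i).2) (hc i) (hc j)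
        linarith
    cases R with
    | innerRe =>
      change |(inner ℂ (x 0 : H) (x 1 : H)).re - (inner ℂ (y 0 : H) (y 1 : H)).re| ≤ ε
      rw [← Complex.sub_re]
      exact (Complex.abs_re_le_norm _).trans (hn 0 1)
    | innerIm =>
      change |(inner ℂ (x 0 : H) (x 1 : H)).im - (inner ℂ (y 0 : H) (y 1 : H)).im| ≤ ε
      rw [← Complex.sub_im]
      exact (Complex.abs_im_le_norm _).trans (hn 0 1)

end

/-- The theory `T_Γ` of unitary representations of `Γ`: all sentences that hold in the unit ball of
every unitary representation of `Γ`. -/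
def repTheory (Γ : Type v) [Group Γ] : Theory (repSignature Γ) :=
  {σ | ∀ (H : Type u) [NormedAddCommGroup H] [InnerProductSpace ℂ H] [CompleteSpace H]
    (π : Γ →* unitary (H →L[ℂ] H)), σ.interp (ballStructure π) ![] = 0}

/-- The formula `d(γ · x, x)`. -/
def moveFormula {Γ : Type v} (γ : Γ) : Formula (repSignature Γ) 1 :=
  .dist (.func (L := repSignature Γ) (k := 1) (RepFunc.act γ) (fun _ => .var 0)) (.var 0)

/-- The formula `max_{γ ∈ F} d(γ · x, x)`. (The connective is the maximum norm on `ℝᵏ`, which is the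
maximum on tuples of nonnegative numbers.) -/
def maxMoveFormula {Γ : Type v} (F : Finset Γ) : Formula (repSignature Γ) 1 :=
  .conn (k := F.card) ⟨fun v => ‖v‖, continuous_norm⟩
    (fun i => moveFormula (F.equivFin.symm i : Γ))

/-- The `T_Γ`-functor `Fix`, sending a model to its set of points fixed by all elements of `Γ`. -/
def fixFunctor (Γ : Type v) [Group Γ] : TFunctor.{u} (repTheory.{u} Γ) 1 where
  obj := fun M => {a | ∀ γ : Γ, M.str.func (RepFunc.act γ) a = a 0}
  isClosed_obj := fun M => by
    rw [Set.ofPred_forall]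
    refine isClosed_iInter fun γ => isClosed_eq ?_ (continuous_apply 0)
    rw [Metric.continuous_iff]
    intro b ε hε
    refine ⟨ε / 2, half_pos hε, fun a hab => ?_⟩
    exact lt_of_le_of_lt
      (M.str.func_modulus (RepFunc.act γ) (ε / 2) (half_pos hε) a b hab) (half_lt_self hε)
  map_mem := fun M N j a ha γ => by
    have h := j.map_formula (moveFormula γ) a
    have e₁ : (moveFormula γ).interp M.str a = dist (M.str.func (RepFunc.act γ) a) (a 0) := by
      simp only [moveFormula, Formula.interp, Term.eval]
      congr 2
      funext i
      rw [Subsingleton.elim i 0]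
    have e₂ : (moveFormula γ).interp N.str (fun i => j.toFun (a i)) =
        dist (N.str.func (RepFunc.act γ) (fun i => j.toFun (a i))) (j.toFun (a 0)) := by
      simp only [moveFormula, Formula.interp, Term.eval]
      congr 2
      funext i
      rw [Subsingleton.elim i 0]
    rw [e₁, e₂, ha γ, dist_self] at h
    exact dist_eq_zero.1 h

/-- The unit ball of a unitary representation, as a model of `T_Γ`. -/
def ballModel {Γ : Type v} [Group Γ] {H : Type u} [NormedAddCommGroup H] [InnerProductSpace ℂ H]
    [CompleteSpace H] (π : Γ →* unitary (H →L[ℂ] H)) : Model.{u} (repTheory.{u} Γ) :=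
  ⟨ballStructure π, fun _ hσ => hσ H π⟩

/-- On the unit ball of a unitary representation `π`, the functor `Fix` is the set of vectors of
`Fix(π)` in the ball. -/
theorem mem_fixFunctor_ballModel {Γ : Type v} [Group Γ] {H : Type u} [NormedAddCommGroup H]
    [InnerProductSpace ℂ H] [CompleteSpace H] (π : Γ →* unitary (H →L[ℂ] H))
    (a : Fin 1 → Metric.closedBall (0 : H) 1) :
    a ∈ (fixFunctor.{u} Γ).obj (ballModel π) ↔ (a 0 : H) ∈ Fix π :=
  forall_congr' fun _ => Subtype.ext_iff

end UnitaryRep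

end

noncomputable section

namespace ContLogic

open Filter Topology

variable {L : MetricSignature.{v, w}}

/-! Definability gives (T) by compactness. If (T) fails, passing to the ergodic part and normalising
yields one ergodic representation with asymptotically invariant unit vectors ζₙ
(`PropertyT.of_forall_isErgodic`). In the ultrapower of its unit ball the class of (ζₙ) is fixed, so
a witness φ vanishes there. By Łoś's theorem (`TFormula.tendsto_interp_ultraproductModel`) φ(ζₙ) is
small for some n, and almost-nearness puts the unit vector ζₙ within 1/2 of a fixed vector, which
can only be 0.

Conversely, (T) yields a Kazhdan pair (F, δ), since a Hilbert sum of ergodic counterexamples would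
have no spectral gap (`PropertyT.exists_isKazhdanPair`). Projection onto the fixed vectors then
gives δ‖x - Px‖ ≤ max_{γ ∈ F} ‖γx - x‖ (`IsKazhdanPair.exists_mem_Fix`). The argument never
identifies a general model of T_Γ with a unit ball. Instead the estimate is written into sentences
of T_Γ (`approxSentence`, `controlSentence`), which hold in all models. They only provide
approximately fixed points, but iteration and completeness produce exact ones
(`IsKazhdanPair.exists_fixed_of_displacement_lt`). The resulting bound d(x, Fix) ≤ δ⁻¹ max_{γ ∈ F}
d(γx, x) gives almost-nearness, and adding the right-hand side as a penalty turns the distance to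
`Fix` into an infimum over the whole sort. -/

/-- A formula is bounded, uniformly over all structures. -/
theorem Formula.exists_abs_interp_le {n : ℕ} (φ : Formula L n) :
    ∃ B : ℝ, ∀ (M : MetricStructure.{u} L) (a : Fin n → M.Carrier), |φ.interp M a| ≤ B := by
  induction φ with
  | rel R t =>
    exact ⟨max |L.relLower R| |L.relUpper R|, fun M a =>
      abs_le_max_abs_abs (M.rel_mem R _).1 (M.rel_mem R _).2⟩
  | dist s t =>
    exact ⟨L.diam, fun M a => by
      simpa only [Formula.interp, abs_of_nonneg dist_nonneg] using M.dist_le_diam _ _⟩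
  | @conn n k c φ ih =>
    choose B hB using ih
    obtain ⟨C, hC⟩ := (isCompact_univ_pi fun i => isCompact_Icc (a := -B i) (b := B i)
      ).exists_bound_of_continuousOn c.continuous.continuousOn
    exact ⟨C, fun M a => hC _ fun i _ => abs_le.1 (hB i M a)⟩
  | sup φ ih =>
    obtain ⟨B, hB⟩ := ih
    refine ⟨B, fun M a => abs_le.2 ⟨?_, ciSup_le fun b => (abs_le.1 (hB M _)).2⟩⟩
    obtain ⟨b⟩ := M.nonempty
    exact (abs_le.1 (hB M (Fin.snoc a b))).1.trans
      (le_ciSup (f := fun b => φ.interp M (Fin.snoc a b))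
        ⟨B, by rintro _ ⟨b, rfl⟩; exact (abs_le.1 (hB M _)).2⟩ b)
  | inf φ ih =>
    obtain ⟨B, hB⟩ := ih
    refine ⟨B, fun M a => abs_le.2 ⟨le_ciInf fun b => (abs_le.1 (hB M _)).1, ?_⟩⟩
    obtain ⟨b⟩ := M.nonempty
    exact (ciInf_le (f := fun b => φ.interp M (Fin.snoc a b))
        ⟨-B, by rintro _ ⟨b, rfl⟩; exact (abs_le.1 (hB M _)).1⟩ b).trans
      (abs_le.1 (hB M (Fin.snoc a b))).2

/-- Real suprema and infima are junk values on unbounded sets, so every use of a quantifier needs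
this and its dual. -/
theorem Formula.bddAbove_range_snoc {n : ℕ} (φ : Formula L (n + 1)) (M : MetricStructure.{u} L)
    (a : Fin n → M.Carrier) : BddAbove (Set.range fun b => φ.interp M (Fin.snoc a b)) := by
  obtain ⟨B, hB⟩ := φ.exists_abs_interp_le
  exact ⟨B, by rintro _ ⟨b, rfl⟩; exact (abs_le.1 (hB M _)).2⟩

theorem Formula.bddBelow_range_snoc {n : ℕ} (φ : Formula L (n + 1)) (M : MetricStructure.{u} L)
    (a : Fin n → M.Carrier) : BddBelow (Set.range fun b => φ.interp M (Fin.snoc a b)) := by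
  obtain ⟨B, hB⟩ := φ.exists_abs_interp_le
  exact ⟨-B, by rintro _ ⟨b, rfl⟩; exact (abs_le.1 (hB M _)).1⟩

/-! ### Ultraproducts of sequences of metric structures -/

/-- The limit of a real sequence along the hyperfilter. -/
def ulim (f : ℕ → ℝ) : ℝ := limUnder (hyperfilter ℕ : Filter ℕ) f

theorem tendsto_ulim {f : ℕ → ℝ} {B : ℝ} (hf : ∀ i, |f i| ≤ B) :
    Tendsto f (hyperfilter ℕ) (𝓝 (ulim f)) := by
  have h : ((hyperfilter ℕ).map f : Filter ℝ) ≤ 𝓟 (Set.Icc (-B) B) :=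
    tendsto_principal.2 (Eventually.of_forall fun i => abs_le.1 (hf i))
  obtain ⟨x, -, hx⟩ := isCompact_Icc.ultrafilter_le_nhds _ h
  exact tendsto_nhds_limUnder ⟨x, hx⟩

variable (M : ℕ → MetricStructure.{u} L)

/-- Sequences of points in a sequence of structures. -/
def UltraSeq : Type u := ∀ i, (M i).Carrier

variable {M}

theorem tendsto_dist_ulim (x y : UltraSeq M) :
    Tendsto (fun i => dist (x i) (y i)) (hyperfilter ℕ) (𝓝 (ulim fun i => dist (x i) (y i))) :=
  tendsto_ulim (B := L.diam) fun i => by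
    simpa only [abs_of_nonneg dist_nonneg] using (M i).dist_le_diam _ _

instance : PseudoMetricSpace (UltraSeq M) where
  dist x y := ulim fun i => dist (x i) (y i)
  dist_self x := tendsto_nhds_unique (tendsto_dist_ulim x x) (by simp)
  dist_comm x y := by simp only [dist_comm]
  dist_triangle x y z := le_of_tendsto_of_tendsto' (tendsto_dist_ulim x z)
    ((tendsto_dist_ulim x y).add (tendsto_dist_ulim y z)) fun i => dist_triangle _ _ _

theorem UltraSeq.tendsto_dist (x y : UltraSeq M) :
    Tendsto (fun i => Dist.dist (x i) (y i)) (hyperfilter ℕ) (𝓝 (Dist.dist x y)) :=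
  tendsto_dist_ulim x y

theorem UltraSeq.eventually_dist_lt {k : ℕ} {x y : Fin k → UltraSeq M} {r : ℝ}
    (h : Dist.dist x y < r) :
    ∀ᶠ i in hyperfilter ℕ, Dist.dist (fun j => x j i) (fun j => y j i) < r := by
  have hr : 0 < r := dist_nonneg.trans_lt h
  simp only [dist_pi_lt_iff hr] at h ⊢
  exact eventually_all.2 fun j => (UltraSeq.tendsto_dist (x j) (y j)).eventually_lt_const (h j)

/-- A diagonal argument using only that the ultrafilter is nonprincipal; completeness of the factors
plays no role. -/
instance : CompleteSpace (UltraSeq M) := by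
  refine Metric.complete_of_convergent_controlled_sequences (fun n => (1 / 2 : ℝ) ^ n)
    (fun n => by positivity) fun u hu => ?_
  -- `P i k` says that the Cauchy estimates among the first k + 1 terms hold in the i-th coordinate.
  -- The limit takes, at coordinate i, the last term k ≤ i up to which they hold.
  let P : ℕ → ℕ → Prop := fun i k => ∀ j ≤ k, ∀ l ≤ k, j ≤ l →
    dist (u j i) (u l i) ≤ (1 / 2 : ℝ) ^ j
  classical
  refine ⟨fun i => u (Nat.findGreatest (P i) i) i, ?_⟩
  have key : ∀ k, dist (u k) (fun i => u (Nat.findGreatest (P i) i) i) ≤ (1 / 2 : ℝ) ^ k := by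
    intro k
    have hP : ∀ᶠ i in hyperfilter ℕ, P i k := by
      have : ∀ j ∈ Set.Iic k, ∀ᶠ i in hyperfilter ℕ, ∀ l ∈ Set.Iic k, j ≤ l →
          dist (u j i) (u l i) ≤ (1 / 2 : ℝ) ^ j := by
        intro j _
        refine (eventually_all_finite (Set.finite_Iic k)).2 fun l _ => ?_
        by_cases hjl : j ≤ l
        · filter_upwards [(UltraSeq.tendsto_dist (u j) (u l)).eventually_lt_const
            (hu j j l le_rfl hjl)] with i hi _ using hi.le
        · exact Eventually.of_forall fun i h => absurd h hjl
      exact (eventually_all_finite (Set.finite_Iic k)).2 this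
    have hk : ∀ᶠ i in hyperfilter ℕ, k ≤ i :=
      (hyperfilter_le_cofinite (α := ℕ)).trans Nat.cofinite_eq_atTop.le (eventually_ge_atTop k)
    refine le_of_tendsto (UltraSeq.tendsto_dist _ _) ?_
    filter_upwards [hP, hk] with i hi hki
    have h₁ : k ≤ Nat.findGreatest (P i) i := Nat.le_findGreatest hki hi
    exact Nat.findGreatest_spec (P := P i) hki hi k h₁ _ le_rfl h₁
  exact tendsto_iff_dist_tendsto_zero.2 (squeeze_zero (fun _ => dist_nonneg) key
    (tendsto_pow_atTop_nhds_zero_of_lt_one (by norm_num) (by norm_num)))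

instance : Nonempty (UltraSeq M) := ⟨fun i => Classical.choice (M i).nonempty⟩

/-- A sequence representing a point of the ultraproduct. -/
def UltraSeq.rep (x : SeparationQuotient (UltraSeq M)) : UltraSeq M :=
  Function.surjInv SeparationQuotient.surjective_mk x

@[simp]
theorem UltraSeq.mk_rep (x : SeparationQuotient (UltraSeq M)) :
    SeparationQuotient.mk (UltraSeq.rep x) = x :=
  Function.surjInv_eq _ x

theorem UltraSeq.dist_rep {k : ℕ} (x y : Fin k → SeparationQuotient (UltraSeq M)) :
    Dist.dist (fun j => UltraSeq.rep (x j)) (fun j => UltraSeq.rep (y j)) = Dist.dist x y := by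
  have h : ∀ j, nndist (UltraSeq.rep (x j)) (UltraSeq.rep (y j)) = nndist (x j) (y j) := fun j => by
    apply NNReal.eq
    rw [coe_nndist, coe_nndist, ← SeparationQuotient.dist_mk, UltraSeq.mk_rep, UltraSeq.mk_rep]
  simp only [dist_pi_def, h]

/-- Coordinatewise application of a function symbol. -/
def UltraSeq.func {k : ℕ} (f : L.Func k) (x : Fin k → UltraSeq M) : UltraSeq M :=
  fun i => (M i).func f fun j => x j i

theorem UltraSeq.dist_func_le {k : ℕ} (f : L.Func k) {ε : ℝ} (hε : 0 < ε)
    {x y : Fin k → UltraSeq M} (h : Dist.dist x y < L.funcModulus f ε) :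
    Dist.dist (UltraSeq.func f x) (UltraSeq.func f y) ≤ ε := by
  refine le_of_tendsto (UltraSeq.tendsto_dist _ _) ?_
  filter_upwards [UltraSeq.eventually_dist_lt h] with i hi
  exact (M i).func_modulus f ε hε _ _ hi

/-- The limit of the values of a relation symbol. -/
def UltraSeq.rel {k : ℕ} (R : L.Rel k) (x : Fin k → UltraSeq M) : ℝ :=
  ulim fun i => (M i).rel R fun j => x j i

theorem UltraSeq.tendsto_rel {k : ℕ} (R : L.Rel k) (x : Fin k → UltraSeq M) :
    Tendsto (fun i => (M i).rel R fun j => x j i) (hyperfilter ℕ) (𝓝 (UltraSeq.rel R x)) :=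
  tendsto_ulim fun i => abs_le_max_abs_abs ((M i).rel_mem R _).1 ((M i).rel_mem R _).2

theorem UltraSeq.abs_rel_sub_le {k : ℕ} (R : L.Rel k) {ε : ℝ} (hε : 0 < ε)
    {x y : Fin k → UltraSeq M} (h : Dist.dist x y < L.relModulus R ε) :
    |UltraSeq.rel R x - UltraSeq.rel R y| ≤ ε := by
  refine le_of_tendsto ((UltraSeq.tendsto_rel R x).sub (UltraSeq.tendsto_rel R y)).abs ?_
  filter_upwards [UltraSeq.eventually_dist_lt h] with i hi
  exact (M i).rel_modulus R ε hε _ _ hi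

variable (M) in
/-- The ultraproduct of a sequence of structures along the hyperfilter. -/
def ultraproduct : MetricStructure.{u} L where
  Carrier := SeparationQuotient (UltraSeq M)
  dist_le_diam x y := by
    obtain ⟨x, rfl⟩ := SeparationQuotient.surjective_mk x
    obtain ⟨y, rfl⟩ := SeparationQuotient.surjective_mk y
    rw [SeparationQuotient.dist_mk]
    exact le_of_tendsto' (UltraSeq.tendsto_dist x y) fun i => (M i).dist_le_diam _ _
  func f x := SeparationQuotient.mk (UltraSeq.func f fun j => UltraSeq.rep (x j))
  rel R x := UltraSeq.rel R fun j => UltraSeq.rep (x j)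
  func_modulus f ε hε x y h := by
    rw [SeparationQuotient.dist_mk]
    exact UltraSeq.dist_func_le f hε (by rwa [UltraSeq.dist_rep])
  rel_mem R x := isClosed_Icc.mem_of_tendsto (UltraSeq.tendsto_rel R _)
    (Eventually.of_forall fun i => (M i).rel_mem R _)
  rel_modulus R ε hε x y h := UltraSeq.abs_rel_sub_le R hε (by rwa [UltraSeq.dist_rep])

/-- The class of a sequence in the ultraproduct. -/
def UltraSeq.mk (x : UltraSeq M) : (ultraproduct M).Carrier := SeparationQuotient.mk x

theorem UltraSeq.mk_surjective : Function.Surjective (UltraSeq.mk (M := M)) :=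
  SeparationQuotient.surjective_mk

theorem UltraSeq.dist_mk (x y : UltraSeq M) : Dist.dist x.mk y.mk = Dist.dist x y :=
  SeparationQuotient.dist_mk x y

theorem UltraSeq.dist_rep_mk {k : ℕ} (x : Fin k → UltraSeq M) :
    Dist.dist (fun j => UltraSeq.rep (x j).mk) x = 0 := by
  refine le_antisymm ((dist_pi_le_iff le_rfl).2 fun j => ?_) dist_nonneg
  rw [← UltraSeq.dist_mk]
  exact (dist_eq_zero.2 (UltraSeq.mk_rep (x j).mk)).le

/-- The chosen representatives are at distance 0 from the given ones, hence below the modulus for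
every ε. -/
theorem ultraproduct_func {k : ℕ} (f : L.Func k) (x : Fin k → UltraSeq M) :
    (ultraproduct M).func f (fun j => (x j).mk) = (UltraSeq.func f x).mk := by
  refine dist_le_zero.1 (le_of_forall_pos_le_add fun ε hε => ?_)
  rw [zero_add]
  refine (UltraSeq.dist_mk _ _).trans_le (UltraSeq.dist_func_le f hε ?_)
  rw [UltraSeq.dist_rep_mk]
  exact L.funcModulus_pos f ε hε

theorem ultraproduct_rel {k : ℕ} (R : L.Rel k) (x : Fin k → UltraSeq M) :
    (ultraproduct M).rel R (fun j => (x j).mk) = UltraSeq.rel R x := by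
  refine eq_of_forall_dist_le fun ε hε => UltraSeq.abs_rel_sub_le R hε ?_
  rw [UltraSeq.dist_rep_mk]
  exact L.relModulus_pos R ε hε

/-! ### Terms and formulae in ultraproducts. -/

theorem ultraproduct_eval {n : ℕ} (t : Term L n) (x : Fin n → UltraSeq M) :
    t.eval (ultraproduct M) (fun j => (x j).mk) =
      UltraSeq.mk fun i => t.eval (M i) fun j => x j i := by
  induction t with
  | var j => rfl
  | func f t ih =>
    simp only [Term.eval, ih]
    exact ultraproduct_func f _

theorem UltraSeq.snoc_mk {n : ℕ} (x : Fin n → UltraSeq M) (y : UltraSeq M) :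
    (Fin.snoc (fun j => (x j).mk) y.mk : Fin (n + 1) → (ultraproduct M).Carrier) =
      fun j => ((Fin.snoc x y : Fin (n + 1) → UltraSeq M) j).mk := by
  funext j
  refine Fin.lastCases ?_ (fun j => ?_) j
  · simp only [Fin.snoc_last]
  · simp only [Fin.snoc_castSucc]

theorem UltraSeq.snoc_apply {n : ℕ} (x : Fin n → UltraSeq M) (y : UltraSeq M) (i : ℕ) :
    (fun j => (Fin.snoc x y : Fin (n + 1) → UltraSeq M) j i) =
      (Fin.snoc (fun j => x j i) (y i) : Fin (n + 1) → (M i).Carrier) := by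
  funext j
  refine Fin.lastCases ?_ (fun j => ?_) j
  · simp only [Fin.snoc_last]
  · simp only [Fin.snoc_castSucc]

/-- **Łoś's theorem** for continuous logic. -/
theorem tendsto_interp_ultraproduct {n : ℕ} (φ : Formula L n) (x : Fin n → UltraSeq M) :
    Tendsto (fun i => φ.interp (M i) fun j => x j i) (hyperfilter ℕ)
      (𝓝 (φ.interp (ultraproduct M) fun j => (x j).mk)) := by
  have inv : Tendsto (fun i : ℕ => 1 / ((i : ℝ) + 1)) (hyperfilter ℕ) (𝓝 0) :=
    tendsto_one_div_add_atTop_nhds_zero_nat.mono_left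
      ((hyperfilter_le_cofinite (α := ℕ)).trans Nat.cofinite_eq_atTop.le)
  induction φ with
  | rel R t =>
    simp only [Formula.interp, ultraproduct_eval]
    exact (UltraSeq.tendsto_rel R _).mono_right (congrArg 𝓝 (ultraproduct_rel R _)).ge
  | dist s t =>
    simp only [Formula.interp, ultraproduct_eval]
    exact (UltraSeq.tendsto_dist _ _).mono_right (congrArg 𝓝 (UltraSeq.dist_mk _ _)).ge
  | conn c φ ih =>
    exact (c.continuous.tendsto _).comp (tendsto_pi_nhds.2 fun i => ih i x)
  | @sup n φ ih =>
    have h : ∀ y : UltraSeq M, Tendsto (fun i => φ.interp (M i) (Fin.snoc (fun j => x j i) (y i)))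
        (hyperfilter ℕ) (𝓝 (φ.interp (ultraproduct M) (Fin.snoc (fun j => (x j).mk) y.mk))) := by
      intro y
      have := ih (Fin.snoc x y)
      simpa only [UltraSeq.snoc_apply, UltraSeq.snoc_mk] using this
    simp only [Formula.interp]
    refine tendsto_order.2 ⟨fun r hr => ?_, fun r hr => ?_⟩
    -- Lower bound: a near-maximiser in the ultraproduct is represented by a sequence, whose
    -- coordinates bound the suprema in the factors from below.
    · obtain ⟨b, hb⟩ := exists_lt_of_lt_ciSup hr
      obtain ⟨y, rfl⟩ := UltraSeq.mk_surjective b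
      filter_upwards [(h y).eventually_const_lt hb] with i hi
      exact hi.trans_le (le_ciSup (φ.bddAbove_range_snoc (M i) _) (y i))
    -- Upper bound: near-maximisers in the factors, with error 1/(i+1) vanishing along the
    -- ultrafilter, assemble to a point of the ultraproduct.
    · have hy : ∀ i : ℕ, ∃ y : (M i).Carrier,
          (⨆ b : (M i).Carrier, φ.interp (M i) (Fin.snoc (fun j => x j i) b)) - 1 / ((i : ℝ) + 1)
            < φ.interp (M i) (Fin.snoc (fun j => x j i) y) := fun i =>
        exists_lt_of_lt_ciSup (sub_lt_self _ (by positivity))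
      choose y hy using hy
      have h' := (h y).add inv
      rw [add_zero] at h'
      filter_upwards [h'.eventually_lt_const
        ((le_ciSup (φ.bddAbove_range_snoc (ultraproduct M) _) (UltraSeq.mk y)).trans_lt hr)]
        with i hi
      linarith [hy i]
  | @inf n φ ih =>
    have h : ∀ y : UltraSeq M, Tendsto (fun i => φ.interp (M i) (Fin.snoc (fun j => x j i) (y i)))
        (hyperfilter ℕ) (𝓝 (φ.interp (ultraproduct M) (Fin.snoc (fun j => (x j).mk) y.mk))) := by
      intro y
      have := ih (Fin.snoc x y)
      simpa only [UltraSeq.snoc_apply, UltraSeq.snoc_mk] using this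
    simp only [Formula.interp]
    refine tendsto_order.2 ⟨fun r hr => ?_, fun r hr => ?_⟩
    · have hy : ∀ i : ℕ, ∃ y : (M i).Carrier,
          φ.interp (M i) (Fin.snoc (fun j => x j i) y) <
          (⨅ b : (M i).Carrier, φ.interp (M i) (Fin.snoc (fun j => x j i) b)) + 1 / ((i : ℝ) + 1) :=
        fun i => exists_lt_of_ciInf_lt (lt_add_of_pos_right _ (by positivity))
      choose y hy using hy
      have h' := (h y).sub inv
      rw [sub_zero] at h'
      filter_upwards [h'.eventually_const_lt
        (hr.trans_le (ciInf_le (φ.bddBelow_range_snoc (ultraproduct M) _) (UltraSeq.mk y)))]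
        with i hi
      linarith [hy i]
    · obtain ⟨b, hb⟩ := exists_lt_of_ciInf_lt hr
      obtain ⟨y, rfl⟩ := UltraSeq.mk_surjective b
      filter_upwards [(h y).eventually_lt_const hb] with i hi
      exact (ciInf_le (φ.bddBelow_range_snoc (M i) _) (y i)).trans_lt hi

/-- The ultraproduct of a sequence of models of `T`. -/
def ultraproductModel {T : Theory L} (M : ℕ → Model.{u} T) : Model.{u} T where
  str := ultraproduct fun i => (M i).str
  models σ hσ := by
    have h := tendsto_interp_ultraproduct (M := fun i => (M i).str) σ ![]
    have e₁ : ∀ i, σ.interp (M i).str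
        (fun j => (![] : Fin 0 → UltraSeq fun i => (M i).str) j i) = 0 := fun i =>
      (congrArg (σ.interp (M i).str) (Subsingleton.elim _ _)).trans ((M i).models σ hσ)
    simp only [e₁] at h
    exact (congrArg (σ.interp _) (Subsingleton.elim _ _)).trans
      (tendsto_nhds_unique h tendsto_const_nhds)

/-! ### `T`-formulae -/

/-- A far enough term of a representing Cauchy sequence works, uniformly over all models. This is
what carries Łoś's theorem from formulae to the completion. -/
theorem TFormula.exists_abs_interp_sub_le {T : Theory L} {n : ℕ} (φ : TFormula.{u} T n) {ε : ℝ}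
    (hε : 0 < ε) : ∃ ψ : Formula L n, ∀ (M : Model.{u} T) (a : Fin n → M.Carrier),
      |φ.interp M a - ψ.interp M.str a| ≤ ε := by
  induction φ using Quotient.inductionOn with
  | h s =>
    obtain ⟨N, hN⟩ := s.2 ε hε
    refine ⟨s.1 N, fun M a => ?_⟩
    obtain ⟨x, hx⟩ := s.tendsto M a
    have e : TFormula.interp (Quotient.mk (formulaSetoid.{u} T n) s) M a = x := hx.limUnder_eq
    rw [e]
    refine le_of_tendsto (hx.sub_const _).abs ?_
    filter_upwards [eventually_ge_atTop N] with i hi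
    exact hN i hi N le_rfl M a

theorem Formula.interp_toTFormula {T : Theory L} {n : ℕ} (φ : Formula L n) (M : Model.{u} T)
    (a : Fin n → M.Carrier) : (φ.toTFormula T).interp M a = φ.interp M.str a :=
  (tendsto_const_nhds (x := φ.interp M.str a) (f := (atTop : Filter ℕ))).limUnder_eq

/-- **Łoś's theorem** for `T`-formulae. -/
theorem TFormula.tendsto_interp_ultraproductModel {T : Theory L} {n : ℕ} (φ : TFormula.{u} T n)
    (M : ℕ → Model.{u} T) (x : Fin n → UltraSeq fun i => (M i).str) :
    Tendsto (fun i => φ.interp (M i) fun j => x j i) (hyperfilter ℕ)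
      (𝓝 (φ.interp (ultraproductModel M) fun j => (x j).mk)) := by
  rw [Metric.tendsto_nhds]
  intro ε hε
  obtain ⟨ψ, hψ⟩ := φ.exists_abs_interp_sub_le (ε := ε / 3) (by positivity)
  filter_upwards [Metric.tendsto_nhds.1 (tendsto_interp_ultraproduct ψ x) (ε / 3) (by positivity)]
    with i hi
  have h₁ := abs_le.1 (hψ (M i) fun j => x j i)
  have h₂ := abs_le.1 (hψ (ultraproductModel M) fun j => (x j).mk)
  have h₃ := abs_lt.1 hi
  change -(ε / 3) ≤ _ - ψ.interp (ultraproduct fun i => (M i).str) _ ∧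
    _ - ψ.interp (ultraproduct fun i => (M i).str) _ ≤ _ at h₂
  rw [Real.dist_eq, abs_lt]
  constructor <;> linarith [h₁.1, h₁.2, h₂.1, h₂.2, h₃.1, h₃.2]

end ContLogic

end

noncomputable section

namespace UnitaryRep

open ContLogic Filter Topology

/-! ### Constructions of unitary representations -/

section

variable {Γ : Type v} [Group Γ] {H : Type u} [NormedAddCommGroup H] [InnerProductSpace ℂ H]
  [CompleteSpace H]

/-- A linear action by isometries, as a unitary representation. -/
def ofIsometric (ρ : Γ →* Module.End ℂ H) (hρ : ∀ γ x, ‖ρ γ x‖ = ‖x‖) :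
    Γ →* unitary (H →L[ℂ] H) :=
  (Unitary.linearIsometryEquiv (𝕜 := ℂ) (H := H)).symm.toMonoidHom.comp
    { toFun := fun γ =>
        { toLinearEquiv := LinearEquiv.ofLinearMap (ρ γ) (ρ γ⁻¹)
            (by rw [← Module.End.mul_eq_comp, ← map_mul, mul_inv_cancel, map_one]; rfl)
            (by rw [← Module.End.mul_eq_comp, ← map_mul, inv_mul_cancel, map_one]; rfl)
          norm_map' := hρ γ }
      map_one' := by ext x; exact LinearMap.congr_fun (map_one ρ) x
      map_mul' := fun γ η => by ext x; exact LinearMap.congr_fun (map_mul ρ γ η) x }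

theorem act_mem_Erg (π : Γ →* unitary (H →L[ℂ] H)) (γ : Γ) {x : H} (hx : x ∈ Erg π) :
    (π γ : H →L[ℂ] H) x ∈ Erg π := by
  refine (Submodule.mem_orthogonal _ _).2 fun y hy => ?_
  -- Since y is fixed, ⟨y, γx⟩ = ⟨γy, γx⟩ = ⟨y, x⟩.
  rw [← hy γ, Unitary.inner_map_map]
  exact (Submodule.mem_orthogonal _ _).1 hx y hy

instance (π : Γ →* unitary (H →L[ℂ] H)) : CompleteSpace (Erg π) :=
  inferInstanceAs (CompleteSpace (Fix π)ᗮ)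

theorem isClosed_Fix (π : Γ →* unitary (H →L[ℂ] H)) : IsClosed (Fix π : Set H) := by
  change IsClosed {ξ : H | ∀ γ : Γ, (π γ : H →L[ℂ] H) ξ = ξ}
  rw [Set.ofPred_forall]
  exact isClosed_iInter fun γ => isClosed_eq (π γ : H →L[ℂ] H).continuous continuous_id

instance (π : Γ →* unitary (H →L[ℂ] H)) : CompleteSpace (Fix π) :=
  (isClosed_Fix π).completeSpace_coe

/-- The restriction of a representation to its ergodic part. -/
def ergRep (π : Γ →* unitary (H →L[ℂ] H)) : Γ →* unitary (Erg π →L[ℂ] Erg π) :=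
  ofIsometric
    { toFun := fun γ => (π γ : H →L[ℂ] H).toLinearMap.restrict fun _ hx => act_mem_Erg π γ hx
      map_one' := by ext x; simp
      map_mul' := fun γ η => by ext x; simp }
    fun γ x => norm_act π γ x

/-- An invariant vector of the restriction is invariant for `π` and orthogonal to all such vectors,
hence to itself. -/
theorem isErgodic_ergRep (π : Γ →* unitary (H →L[ℂ] H)) : IsErgodic (ergRep π) := by
  refine (Submodule.eq_bot_iff _).2 fun x hx => Subtype.ext ?_
  have h : (x : H) ∈ Fix π := fun γ => congrArg Subtype.val (hx γ)
  exact inner_self_eq_zero.1 ((Submodule.mem_orthogonal _ _).1 x.2 x h)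

theorem Erg_eq_top {π : Γ →* unitary (H →L[ℂ] H)} (h : IsErgodic π) : Erg π = ⊤ := by
  rw [Erg, show Fix π = ⊥ from h, Submodule.bot_orthogonal_eq_top]

end

/-! ### Hilbert sums of unitary representations. -/

section

variable {Γ : Type v} [Group Γ] {ι : Type w} {H : ι → Type u} [∀ i, NormedAddCommGroup (H i)]
  [∀ i, InnerProductSpace ℂ (H i)] [∀ i, CompleteSpace (H i)]
  (π : ∀ i, Γ →* unitary (H i →L[ℂ] H i))

theorem memℓp_act (γ : Γ) (f : lp H 2) :
    Memℓp (fun i => (π i γ : H i →L[ℂ] H i) (f i)) 2 :=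
  memℓp_gen (by simpa only [norm_act] using (lp.memℓp f).summable (by norm_num))

/-- The coordinatewise action on a Hilbert sum. -/
def sumAct (γ : Γ) : Module.End ℂ (lp H 2) where
  toFun f := ⟨fun i => (π i γ : H i →L[ℂ] H i) (f i), memℓp_act π γ f⟩
  map_add' f g := Subtype.ext (funext fun i => map_add (π i γ : H i →L[ℂ] H i) (f i) (g i))
  map_smul' c f := Subtype.ext (funext fun i => map_smul (π i γ : H i →L[ℂ] H i) c (f i))

theorem sumAct_apply (γ : Γ) (f : lp H 2) (i : ι) :
    sumAct π γ f i = (π i γ : H i →L[ℂ] H i) (f i) :=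
  rfl

theorem norm_sumAct (γ : Γ) (f : lp H 2) : ‖sumAct π γ f‖ = ‖f‖ := by
  rw [lp.norm_eq_tsum_rpow (by norm_num), lp.norm_eq_tsum_rpow (by norm_num)]
  simp only [sumAct_apply, norm_act]

/-- The Hilbert sum of unitary representations. -/
def sumRep : Γ →* unitary (lp H 2 →L[ℂ] lp H 2) :=
  ofIsometric
    { toFun := sumAct π
      map_one' := LinearMap.ext fun f => lp.ext (funext fun i => by
        rw [sumAct_apply, map_one]; rfl)
      map_mul' := fun γ η => LinearMap.ext fun f => lp.ext (funext fun i => by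
        rw [sumAct_apply, map_mul]; rfl) }
    (norm_sumAct π)

theorem sumRep_apply (γ : Γ) (f : lp H 2) (i : ι) :
    ((sumRep π γ : lp H 2 →L[ℂ] lp H 2) f) i = (π i γ : H i →L[ℂ] H i) (f i) :=
  rfl

theorem sumRep_single [DecidableEq ι] (γ : Γ) (i : ι) (x : H i) :
    (sumRep π γ : lp H 2 →L[ℂ] lp H 2) (lp.single 2 i x) =
      lp.single 2 i ((π i γ : H i →L[ℂ] H i) x) := by
  ext j
  rw [sumRep_apply]
  obtain rfl | hij := eq_or_ne j i
  · simp only [lp.single_apply_self]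
  · rw [lp.single_apply_ne _ _ _ hij, lp.single_apply_ne _ _ _ hij, map_zero]

theorem isErgodic_sumRep (h : ∀ i, IsErgodic (π i)) : IsErgodic (sumRep π) := by
  refine (Submodule.eq_bot_iff _).2 fun f hf => ?_
  ext i
  have : f i ∈ Fix (π i) := fun γ => by rw [← sumRep_apply, hf γ]
  rw [show Fix (π i) = ⊥ from h i] at this
  exact this

end

/-! ### Property (T) and Kazhdan pairs -/

section

variable {Γ : Type v} [Group Γ]

/-- Countability of the group enters here: sequences suffice to test all finite sets. -/
theorem exists_finset_exhaustion (Γ : Type v) [Countable Γ] [Nonempty Γ] :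
    ∃ F : ℕ → Finset Γ, ∀ S : Finset Γ, ∀ᶠ n in atTop, S ⊆ F n := by
  classical
  obtain ⟨e, he⟩ := exists_surjective_nat Γ
  refine ⟨fun n => (Finset.range n).image e, fun S => ?_⟩
  have : ∀ γ ∈ S, ∀ᶠ n in atTop, γ ∈ (Finset.range n).image e := fun γ _ => by
    obtain ⟨k, rfl⟩ := he γ
    filter_upwards [eventually_gt_atTop k] with n hn
    exact Finset.mem_image_of_mem e (Finset.mem_range.2 hn)
  exact (eventually_all_finset S).2 this

/-- If each pair (Fₙ, 1/(n+1)) fails, the counterexamples are ergodic and so is their Hilbert sum. A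
spectral gap (S, c) of the sum then applies to vectors supported in a single summand, which is
impossible once S ⊆ Fₙ and 1/(n+1) < c. -/
theorem PropertyT.exists_isKazhdanPair [Countable Γ] (hT : PropertyT.{u} Γ) :
    ∃ (F : Finset Γ) (δ : ℝ), IsKazhdanPair.{u} Γ F δ := by
  classical
  obtain ⟨F, hF⟩ := exists_finset_exhaustion Γ
  by_contra! hno
  have h : ∀ n : ℕ, ¬ IsKazhdanPair.{u} Γ (F n) (1 / ((n : ℝ) + 1)) := fun n => hno _ _
  simp only [IsKazhdanPair, not_and, not_forall, not_not] at h
  choose H i₁ i₂ i₃ π hξ hπ using fun n => h n (by positivity)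
  choose ξ hξ₀ hξ using hξ
  obtain ⟨S, c, hc, hS⟩ := hT (lp H 2) (sumRep π)
  obtain ⟨N, hN⟩ := exists_nat_one_div_lt hc
  obtain ⟨n, hn, hnN⟩ := ((hF S).and (eventually_ge_atTop N)).exists
  obtain ⟨γ, hγ, hle⟩ := hS (lp.single 2 n (ξ n))
    (by rw [Erg_eq_top (isErgodic_sumRep π hπ)]; exact Submodule.mem_top)
  rw [sumRep_single, ← lp.single_sub, lp.norm_single (by norm_num), lp.norm_single (by norm_num)]
    at hle
  have h₁ := hξ n γ (hn hγ)
  have h₂ : 1 / ((n : ℝ) + 1) < c :=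
    (one_div_le_one_div_of_le (by positivity) (by simpa using hnN)).trans_lt hN
  exact absurd (hle.trans_lt h₁) (not_lt.2 (mul_le_mul_of_nonneg_right h₂.le (norm_nonneg _)))

/-- Take y to be the orthogonal projection of x. The remainder x - y lies in the ergodic part and is
displaced exactly as x is, so a violation of the bound would make it almost invariant there. -/
theorem IsKazhdanPair.exists_mem_Fix {F : Finset Γ} {δ : ℝ} (hF : IsKazhdanPair.{u} Γ F δ)
    {H : Type u} [NormedAddCommGroup H] [InnerProductSpace ℂ H] [CompleteSpace H]
    (π : Γ →* unitary (H →L[ℂ] H)) {x : H} {r : ℝ} (hr : 0 ≤ r)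
    (hx : ∀ γ ∈ F, ‖(π γ : H →L[ℂ] H) x - x‖ ≤ r) :
    ∃ y ∈ Fix π, ‖y‖ ≤ ‖x‖ ∧ δ * ‖x - y‖ ≤ r := by
  refine ⟨(Fix π).starProjection x, Submodule.starProjection_apply_mem _ _,
    (Fix π).norm_starProjection_apply_le x, ?_⟩
  by_contra! hlt
  set y := (Fix π).starProjection x with hy
  have hyF : y ∈ Fix π := Submodule.starProjection_apply_mem _ _
  have hq : x - y ∈ Erg π := Submodule.sub_starProjection_mem_orthogonal x
  refine hF.2 (Erg π) (ergRep π) ⟨⟨x - y, hq⟩, ?_, fun γ hγ => ?_⟩ (isErgodic_ergRep π)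
  · intro h0
    have h0 : x - y = 0 := congrArg Subtype.val h0
    rw [h0, norm_zero, mul_zero] at hlt
    exact absurd hr (not_le.2 hlt)
  · change ‖(π γ : H →L[ℂ] H) (x - y) - (x - y)‖ < δ * ‖x - y‖
    rw [map_sub, hyF γ, sub_sub_sub_cancel_right]
    exact (hx γ hγ).trans_lt hlt

/-- A representation without spectral gap violates the gap inequality along an exhaustion of the
group with constants tending to 0; the violating vectors are normalised inside its ergodic part. -/
theorem PropertyT.of_forall_isErgodic [Countable Γ]
    (h : ∀ (H : Type u) [NormedAddCommGroup H] [InnerProductSpace ℂ H] [CompleteSpace H]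
      (π : Γ →* unitary (H →L[ℂ] H)), IsErgodic π → ∀ ζ : ℕ → H, (∀ n, ‖ζ n‖ = 1) →
      ¬ ∀ γ, Tendsto (fun n => (π γ : H →L[ℂ] H) (ζ n) - ζ n) atTop (𝓝 0)) :
    PropertyT.{u} Γ := by
  classical
  intro H _ _ _ π
  by_contra hgap
  simp only [HasSpectralGap, not_exists, not_and, not_forall, not_le] at hgap
  obtain ⟨F, hF⟩ := exists_finset_exhaustion Γ
  -- The identity is inserted because its strict inequality 0 < c‖ζ‖ forces ζ ≠ 0.
  choose ζ hζ hlt using fun n : ℕ => hgap (insert 1 (F n)) (1 / ((n : ℝ) + 1)) (by positivity)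
  have hpos : ∀ n, 0 < ‖ζ n‖ := fun n => by
    have := hlt n 1 (Finset.mem_insert_self _ _)
    rw [map_one] at this
    simp only [OneMemClass.coe_one, one_apply_eq_self, sub_self, norm_zero] at this
    exact (pos_iff_pos_of_mul_pos this).1 (by positivity)
  let ξ : ℕ → Erg π := fun n => ((‖ζ n‖⁻¹ : ℝ) : ℂ) • ⟨ζ n, hζ n⟩
  refine h (Erg π) (ergRep π) (isErgodic_ergRep π) ξ (fun n => ?_) fun γ => ?_
  · change ‖((‖ζ n‖⁻¹ : ℝ) : ℂ) • (⟨ζ n, hζ n⟩ : Erg π)‖ = 1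
    rw [norm_smul, Complex.norm_real, norm_inv, norm_norm]
    exact inv_mul_cancel₀ (hpos n).ne'
  · rw [tendsto_zero_iff_norm_tendsto_zero]
    refine squeeze_zero' (Eventually.of_forall fun _ => norm_nonneg _) ?_
      tendsto_one_div_add_atTop_nhds_zero_nat
    filter_upwards [hF {γ}] with n hn
    have h₁ := hlt n γ (Finset.mem_insert_of_mem (hn (Finset.mem_singleton_self γ)))
    change ‖(ergRep π γ : Erg π →L[ℂ] Erg π) (((‖ζ n‖⁻¹ : ℝ) : ℂ) • ⟨ζ n, hζ n⟩) -
      ((‖ζ n‖⁻¹ : ℝ) : ℂ) • (⟨ζ n, hζ n⟩ : Erg π)‖ ≤ _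
    rw [map_smul, ← smul_sub, norm_smul, Complex.norm_real, norm_inv, norm_norm,
      inv_mul_le_iff₀ (hpos n), mul_comm]
    exact h₁.le

end

/-! ### Definability of `Fix` implies property (T) -/

/-- The ultrapower turns asymptotic invariance into exact invariance, and almost-nearness brings the
fixed point back to the original ball. -/
theorem propertyT_of_isDefinable {Γ : Type v} [Group Γ] [Countable Γ]
    (h : (fixFunctor.{u} Γ).IsDefinable) : PropertyT.{u} Γ := by
  obtain ⟨φ, ⟨-, hnear⟩, hzero⟩ := h
  refine PropertyT.of_forall_isErgodic fun H _ _ _ π hπ ζ hζ hinv => ?_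
  -- Any tolerance below 1 would do: unit vectors are at distance 1 from 0, the only fixed vector.
  obtain ⟨δ, hδ, hnear⟩ := hnear (1 / 2) (by norm_num)
  let x : UltraSeq fun _ : ℕ => (ballModel π).str :=
    fun n => (⟨ζ n, mem_closedBall_zero_iff.2 (hζ n).le⟩ : Metric.closedBall (0 : H) 1)
  have hfix : (fun _ => x.mk) ∈ (fixFunctor Γ).obj (ultraproductModel fun _ => ballModel π) := by
    intro γ
    refine (ultraproduct_func (L := repSignature Γ) (k := 1) (RepFunc.act γ) fun _ => x).trans ?_
    refine dist_eq_zero.1 ((UltraSeq.dist_mk _ _).trans ?_)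
    refine tendsto_nhds_unique (UltraSeq.tendsto_dist _ _) ?_
    have := (tendsto_zero_iff_norm_tendsto_zero.1 (hinv γ)).mono_left
      ((hyperfilter_le_cofinite (α := ℕ)).trans Nat.cofinite_eq_atTop.le)
    refine this.congr fun n => ?_
    rw [← dist_eq_norm]
    rfl
  rw [hzero] at hfix
  have hlim := φ.tendsto_interp_ultraproductModel (fun _ => ballModel π) fun _ => x
  rw [show φ.interp (ultraproductModel fun _ => ballModel π) (fun _ => x.mk) = 0 from hfix] at hlim
  obtain ⟨n, hn⟩ := (hlim.eventually_lt_const hδ).exists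
  obtain ⟨b, hb, hb₀⟩ := hnear (ballModel π) _ hn
  have hbF : b ∈ (fixFunctor.{u} Γ).obj (ballModel π) := by rw [hzero]; exact hb₀
  let y : Metric.closedBall (0 : H) 1 := b 0
  have hbF : (y : H) ∈ Fix π := (mem_fixFunctor_ballModel π b).1 hbF
  rw [show Fix π = ⊥ from hπ, Submodule.mem_bot] at hbF
  have hd : dist (ζ n) (y : H) ≤ 1 / 2 :=
    (dist_le_pi_dist (fun _ => x n) b 0).trans hb
  rw [hbF, dist_zero_right, hζ n] at hd
  norm_num at hd

end UnitaryRep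

end

noncomputable section

namespace UnitaryRep

open ContLogic Filter Topology

/-! ### Kazhdan pairs witness that `Fix` is definable -/

section

variable {Γ : Type v}

/-- The formula `d(γ · xᵢ, xᵢ)`. -/
def moveFormulaAt {n : ℕ} (i : Fin n) (γ : Γ) : Formula (repSignature Γ) n :=
  .dist (.func (L := repSignature Γ) (k := 1) (RepFunc.act γ) (fun _ => .var i)) (.var i)

/-- The formula `max_{γ ∈ F} d(γ · xᵢ, xᵢ)`. -/
def maxMoveFormulaAt {n : ℕ} (i : Fin n) (F : Finset Γ) : Formula (repSignature Γ) n :=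
  .conn (k := F.card) ⟨fun v => ‖v‖, continuous_norm⟩
    (fun j => moveFormulaAt i (F.equivFin.symm j : Γ))

/-- The action of a group element on a structure. -/
def act (M : MetricStructure.{u} (repSignature Γ)) (γ : Γ) (x : M.Carrier) : M.Carrier :=
  M.func (k := 1) (RepFunc.act γ) fun _ => x

/-- The maximal displacement `max_{γ ∈ F} d(γ · x, x)`. -/
def displacement (M : MetricStructure.{u} (repSignature Γ)) (F : Finset Γ) (x : M.Carrier) : ℝ :=
  ‖fun j : Fin F.card => dist (act M (F.equivFin.symm j : Γ) x) x‖

variable (M : MetricStructure.{u} (repSignature Γ)) (F : Finset Γ)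

theorem interp_maxMoveFormula (a : Fin 1 → M.Carrier) :
    (maxMoveFormula F).interp M a = displacement M F (a 0) :=
  rfl

theorem displacement_nonneg (x : M.Carrier) : 0 ≤ displacement M F x :=
  norm_nonneg _

variable {M F}

theorem displacement_le_iff {x : M.Carrier} {r : ℝ} (hr : 0 ≤ r) :
    displacement M F x ≤ r ↔ ∀ γ ∈ F, dist (act M γ x) x ≤ r := by
  simp only [displacement, pi_norm_le_iff_of_nonneg hr, Real.norm_eq_abs,
    abs_of_nonneg dist_nonneg]
  refine ⟨fun h γ hγ => ?_, fun h j => h _ (F.equivFin.symm j).2⟩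
  simpa only [Equiv.symm_apply_apply] using h (F.equivFin ⟨γ, hγ⟩)

variable (M) in
theorem continuous_act (γ : Γ) : Continuous (act M γ) := by
  refine Metric.continuous_iff.2 fun b ε hε => ⟨ε / 2, half_pos hε, fun a hab => ?_⟩
  refine (M.func_modulus (k := 1) (RepFunc.act γ) (ε / 2) (half_pos hε) _ _ ?_).trans_lt
    (half_lt_self hε)
  exact (dist_pi_lt_iff (half_pos hε)).2 fun _ => hab

theorem displacement_eq_zero_of_fixed (F : Finset Γ)
    {x : M.Carrier} (hx : ∀ γ, act M γ x = x) : displacement M F x = 0 :=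
  le_antisymm ((displacement_le_iff le_rfl).2 fun γ _ => by rw [hx γ, dist_self])
    (displacement_nonneg M F x)

/-- The sentence `sup_x inf_y max(δ d(x, y) - max_{γ ∈ F} d(γx, x), max_{γ ∈ F} d(γy, y))`. -/
def approxSentence (F : Finset Γ) (δ : ℝ) : Formula (repSignature Γ) 0 :=
  .sup (.inf (.conn (k := 3)
    ⟨fun v => max (max (δ * v 0 - v 1) 0) (v 2), by fun_prop⟩
    ![.dist (.var 0) (.var 1), maxMoveFormulaAt 0 F, maxMoveFormulaAt 1 F]))

/-- The sentence `sup_x (δ d(γx, x) ∸ 2 max_{η ∈ F} d(ηx, x))`. -/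
def controlSentence (F : Finset Γ) (δ : ℝ) (γ : Γ) : Formula (repSignature Γ) 0 :=
  .sup (.conn (k := 2) ⟨fun v => max (δ * v 0 - 2 * v 1) 0, by fun_prop⟩
    ![moveFormulaAt 0 γ, maxMoveFormulaAt 0 F])

/-- The formula `inf_y (d(x, y) + δ⁻¹ max_{γ ∈ F} d(γy, y))`. -/
def distFixFormula (F : Finset Γ) (δ : ℝ) : Formula (repSignature Γ) 1 :=
  .inf (.conn (k := 2) ⟨fun v => v 0 + δ⁻¹ * v 1, by fun_prop⟩
    ![.dist (.var 0) (.var 1), maxMoveFormulaAt 1 F])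

variable (M F) (δ : ℝ)

theorem interp_approxSentence :
    (approxSentence F δ).interp M ![] = ⨆ x : M.Carrier, ⨅ y : M.Carrier,
      max (max (δ * dist x y - displacement M F x) 0) (displacement M F y) :=
  rfl

theorem interp_controlSentence (γ : Γ) :
    (controlSentence F δ γ).interp M ![] = ⨆ x : M.Carrier,
      max (δ * dist (act M γ x) x - 2 * displacement M F x) 0 :=
  rfl

theorem interp_distFixFormula (a : Fin 1 → M.Carrier) :
    (distFixFormula F δ).interp M a = ⨅ y : M.Carrier,
      (dist (a 0) y + δ⁻¹ * displacement M F y) :=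
  rfl

end

section

variable {Γ : Type v} [Group Γ]

theorem mem_fixFunctor_iff (M : Model.{u} (repTheory.{u} Γ)) (a : Fin 1 → M.Carrier) :
    a ∈ (fixFunctor.{u} Γ).obj M ↔ ∀ γ, act M.str γ (a 0) = a 0 := by
  refine forall_congr' fun γ => ?_
  have : (fun _ => a 0) = a := funext fun i => congrArg a (Subsingleton.elim 0 i)
  rw [act, this]

theorem dist_act_ball {H : Type u} [NormedAddCommGroup H] [InnerProductSpace ℂ H]
    [CompleteSpace H] (π : Γ →* unitary (H →L[ℂ] H)) (γ : Γ) (x : Metric.closedBall (0 : H) 1) :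
    dist (act (ballStructure π) γ x) x = ‖(π γ : H →L[ℂ] H) x - x‖ :=
  dist_eq_norm (E := H) _ _

end

section

variable {Γ : Type v} [Group Γ] {F : Finset Γ} {δ : ℝ}

theorem IsKazhdanPair.exists_fixed_ball (hF : IsKazhdanPair.{u} Γ F δ)
    {H : Type u} [NormedAddCommGroup H] [InnerProductSpace ℂ H] [CompleteSpace H]
    (π : Γ →* unitary (H →L[ℂ] H)) (x : (ballStructure π).Carrier) :
    ∃ y : (ballStructure π).Carrier, (∀ γ, act (ballStructure π) γ y = y) ∧
      δ * dist x y ≤ displacement (ballStructure π) F x := by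
  let x' : Metric.closedBall (0 : H) 1 := x
  obtain ⟨y, hy, hyx, hd⟩ := hF.exists_mem_Fix π (x := (x' : H)) (displacement_nonneg _ F x)
    fun γ hγ => (dist_act_ball π γ x').symm.trans_le
      ((displacement_le_iff (displacement_nonneg _ F x)).1 le_rfl γ hγ)
  let y' : Metric.closedBall (0 : H) 1 :=
    ⟨y, mem_closedBall_zero_iff.2 (hyx.trans (mem_closedBall_zero_iff.1 x'.2))⟩
  refine ⟨y', fun γ => Subtype.ext (hy γ), ?_⟩
  change δ * dist (x' : H) (y' : H) ≤ _
  rwa [dist_eq_norm]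

/-- In a unit ball the inner infimum is attained with value 0 at the projection of x, by
`IsKazhdanPair.exists_fixed_ball`. -/
theorem IsKazhdanPair.approxSentence_mem (hF : IsKazhdanPair.{u} Γ F δ) :
    approxSentence F δ ∈ repTheory.{u} Γ := by
  intro H _ _ _ π
  rw [interp_approxSentence]
  have : ∀ x : (ballStructure π).Carrier, (⨅ y : (ballStructure π).Carrier,
      max (max (δ * dist x y - displacement (ballStructure π) F x) 0)
        (displacement (ballStructure π) F y)) = 0 := fun x => by
    obtain ⟨y, hy, hxy⟩ := hF.exists_fixed_ball π x
    refine le_antisymm ?_ (le_ciInf fun y => (le_max_right _ _).trans (le_max_left _ _))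
    refine (ciInf_le ⟨0, ?_⟩ y).trans ?_
    · rintro _ ⟨y, rfl⟩
      exact (le_max_right _ _).trans (le_max_left _ _)
    · exact max_le (max_le (sub_nonpos.2 hxy) le_rfl) (displacement_eq_zero_of_fixed F hy).le
  simp only [this, ciSup_const]

/-- For a fixed y, d(γx, x) ≤ d(γx, γy) + d(y, x) = 2 d(x, y), whence the factor 2. The sentence
lets F alone detect points fixed by the whole group, in every model. -/
theorem IsKazhdanPair.controlSentence_mem (hF : IsKazhdanPair.{u} Γ F δ) (γ : Γ) :
    controlSentence F δ γ ∈ repTheory.{u} Γ := by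
  intro H _ _ _ π
  rw [interp_controlSentence]
  have : ∀ x : (ballStructure π).Carrier, max (δ * dist (act (ballStructure π) γ x) x -
      2 * displacement (ballStructure π) F x) 0 = 0 := fun x => by
    obtain ⟨y, hy, hxy⟩ := hF.exists_fixed_ball π x
    refine max_eq_right (sub_nonpos.2 ?_)
    have h₁ : dist (act (ballStructure π) γ x) y ≤ dist x y := by
      let x' : Metric.closedBall (0 : H) 1 := x
      let y' : Metric.closedBall (0 : H) 1 := y
      conv_lhs => rw [← hy γ]
      change dist ((π γ : H →L[ℂ] H) (x' : H)) ((π γ : H →L[ℂ] H) (y' : H)) ≤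
        dist (x' : H) (y' : H)
      rw [dist_eq_norm, dist_eq_norm, ← map_sub, norm_act]
    have h₂ := dist_triangle_right (act (ballStructure π) γ x) x y
    nlinarith [hF.1]
  simp only [this, ciSup_const]

/-! ### Transfer of the Kazhdan estimate to arbitrary models. -/

variable (M : Model.{u} (repTheory.{u} Γ))

theorem IsKazhdanPair.dist_act_le (hF : IsKazhdanPair.{u} Γ F δ) (γ : Γ) (x : M.Carrier) :
    δ * dist (act M.str γ x) x ≤ 2 * displacement M.str F x := by
  have h := M.models _ (hF.controlSentence_mem γ)
  have := (le_ciSup (Formula.bddAbove_range_snoc _ M.str ![]) x).trans_eq h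
  exact sub_nonpos.1 ((le_max_left _ _).trans this)

theorem IsKazhdanPair.exists_dist_lt (hF : IsKazhdanPair.{u} Γ F δ) (x : M.Carrier) {ε : ℝ}
    (hε : 0 < ε) : ∃ y : M.Carrier, δ * dist x y < displacement M.str F x + ε ∧
      displacement M.str F y < ε := by
  have h := M.models _ hF.approxSentence_mem
  have := ((le_ciSup (Formula.bddAbove_range_snoc _ M.str ![]) x).trans_eq h).trans_lt hε
  obtain ⟨y, hy⟩ := exists_lt_of_ciInf_lt this
  have hy : max (max (δ * dist x y - displacement M.str F x) 0) (displacement M.str F y) < ε := hy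
  obtain ⟨hy₁, hy₂⟩ := max_lt_iff.1 hy
  exact ⟨y, by linarith [(max_lt_iff.1 hy₁).1], hy₂⟩

theorem IsKazhdanPair.fixed_iff (hF : IsKazhdanPair.{u} Γ F δ) (x : M.Carrier) :
    (∀ γ, act M.str γ x = x) ↔ displacement M.str F x = 0 := by
  refine ⟨displacement_eq_zero_of_fixed F, fun h γ => ?_⟩
  have := hF.dist_act_le M γ x
  rw [h, mul_zero] at this
  exact dist_le_zero.1 (nonpos_of_mul_nonpos_right this hF.1)

/-- Repeatedly replacing a point by a nearby one of half the displacement bound gives a Cauchy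
sequence. Its steps are at most (2η/δ)2⁻ⁿ, with sum 4η/δ. -/
theorem IsKazhdanPair.exists_fixed_of_displacement_lt (hF : IsKazhdanPair.{u} Γ F δ)
    {x : M.Carrier} {η : ℝ} (hη : displacement M.str F x < η) :
    ∃ y : M.Carrier, (∀ γ, act M.str γ y = y) ∧ δ * dist x y ≤ 4 * η := by
  have hδ := hF.1
  have hη₀ : 0 < η := (displacement_nonneg _ _ _).trans_lt hη
  choose! g hg₁ hg₂ using fun (n : ℕ) (x : M.Carrier) =>
    hF.exists_dist_lt M x (ε := η * (1 / 2) ^ (n + 1)) (by positivity)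
  let y : ℕ → M.Carrier := fun n => Nat.rec x g n
  have hy : ∀ n, displacement M.str F (y n) < η * (1 / 2) ^ n := by
    rintro (_ | n)
    · simpa [y] using hη
    · exact hg₂ n (y n)
  have hd : ∀ n, dist (y n) (y (n + 1)) ≤ 2 * η / δ * (1 / 2) ^ n := fun n => by
    have h₁ : δ * dist (y n) (y (n + 1)) < _ := hg₁ n (y n)
    have h₂ := hy n
    rw [div_mul_eq_mul_div, le_div_iff₀ hδ]
    have h₃ : η * (1 / 2) ^ (n + 1) ≤ η * (1 / 2) ^ n :=
      mul_le_mul_of_nonneg_left (pow_le_pow_of_le_one (by norm_num) (by norm_num) n.le_succ) hη₀.le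
    linarith
  obtain ⟨z, hz⟩ := cauchySeq_tendsto_of_complete
    (cauchySeq_of_le_geometric (1 / 2) _ (by norm_num) hd)
  refine ⟨z, fun γ => ?_, ?_⟩
  -- The limit is fixed by every γ, not just those in F: the control sentence bounds d(γyₙ, yₙ) by
  -- 2η2⁻ⁿ/δ.
  · have h₁ : Tendsto (fun n => dist (act M.str γ (y n)) (y n)) atTop
        (𝓝 (dist (act M.str γ z) z)) :=
      (((continuous_act M.str γ).tendsto z).comp hz).dist hz
    have h₂ : Tendsto (fun n : ℕ => 2 * (η * (1 / 2 : ℝ) ^ n) / δ) atTop (𝓝 0) := by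
      have := ((tendsto_pow_atTop_nhds_zero_of_lt_one (r := (1 / 2 : ℝ)) (by norm_num)
        (by norm_num)).const_mul η).const_mul 2 |>.div_const δ
      simpa only [mul_zero, zero_div] using this
    refine dist_le_zero.1 (le_of_tendsto_of_tendsto' h₁ h₂ fun n => ?_)
    rw [le_div_iff₀ hδ]
    linarith [hF.dist_act_le M γ (y n), hy n]
  · have := dist_le_of_le_geometric_of_tendsto₀ (1 / 2) _ (by norm_num) hd hz
    calc δ * dist x z ≤ δ * (2 * η / δ / (1 - 1 / 2)) := mul_le_mul_of_nonneg_left this hδ.le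
      _ = 4 * η := by field_simp; norm_num

/-- In a model of `T_Γ` the distance to `Fix` is at most `δ⁻¹ max_{γ ∈ F} d(γ · x, x)`. -/
theorem IsKazhdanPair.exists_fixed (hF : IsKazhdanPair.{u} Γ F δ) (x : M.Carrier) {ε : ℝ}
    (hε : 0 < ε) : ∃ y : M.Carrier, (∀ γ, act M.str γ y = y) ∧
      dist x y ≤ δ⁻¹ * displacement M.str F x + ε := by
  have hδ := hF.1
  -- With tolerance ε' = δε/5, the first move costs an extra ε' and the passage to an exact fixed
  -- point 4ε'.
  obtain ⟨y, hxy, hy⟩ := hF.exists_dist_lt M x (ε := δ * ε / 5) (by positivity)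
  obtain ⟨z, hz, hyz⟩ := hF.exists_fixed_of_displacement_lt M hy
  refine ⟨z, hz, ?_⟩
  have h : δ * dist x z ≤ displacement M.str F x + δ * ε := by
    nlinarith [dist_triangle x y z]
  calc dist x z = δ⁻¹ * (δ * dist x z) := by field_simp
    _ ≤ δ⁻¹ * (displacement M.str F x + δ * ε) := by gcongr
    _ = _ := by field_simp

/-! ### The witness and the distance formula. -/

theorem dist_fin_one {X : Type u} [PseudoMetricSpace X] (a b : Fin 1 → X) :
    dist a b = dist (a 0) (b 0) :=
  le_antisymm ((dist_pi_le_iff dist_nonneg).2 fun i => by rw [Subsingleton.elim i 0])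
    (dist_le_pi_dist a b 0)

theorem IsKazhdanPair.isWitness (hF : IsKazhdanPair.{u} Γ F δ) :
    (fixFunctor.{u} Γ).IsWitness ((maxMoveFormula F).toTFormula (repTheory.{u} Γ)) := by
  have hδ := hF.1
  refine ⟨⟨fun M a => ?_, fun ε hε => ⟨δ * (ε / 2), by positivity, fun M a ha => ?_⟩⟩, fun M => ?_⟩
  · rw [Formula.interp_toTFormula]
    exact displacement_nonneg _ _ _
  · rw [Formula.interp_toTFormula, interp_maxMoveFormula] at ha
    obtain ⟨y, hy, hd⟩ := hF.exists_fixed M (a 0) (half_pos hε)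
    refine ⟨fun _ => y, ?_, ?_⟩
    · rw [dist_fin_one]
      have := (inv_mul_lt_iff₀ hδ).2 ha
      linarith
    · rw [Formula.interp_toTFormula]
      exact displacement_eq_zero_of_fixed F hy
  · ext a
    rw [mem_fixFunctor_iff, hF.fixed_iff, TFormula.zeroset, Set.mem_ofPred_eq,
      Formula.interp_toTFormula]
    rfl

/-- At fixed y the penalty vanishes, so the infimum is at most the distance. For any other y the
penalty dominates d(y, Fix), and the triangle inequality gives the reverse bound. -/
theorem IsKazhdanPair.interp_distFixFormula_eq (hF : IsKazhdanPair.{u} Γ F δ)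
    (a : Fin 1 → M.Carrier) :
    (distFixFormula F δ).interp M.str a = Metric.infDist a ((fixFunctor.{u} Γ).obj M) := by
  have hδ := hF.1
  rw [interp_distFixFormula]
  refine le_antisymm ?_ (le_ciInf fun y => le_of_forall_pos_le_add fun ε hε => ?_)
  -- Only the existence of a fixed point matters here: `Metric.le_infDist` requires a nonempty set.
  · obtain ⟨y, hy, -⟩ := hF.exists_fixed M (a 0) one_pos
    refine (Metric.le_infDist ⟨fun _ => y, (mem_fixFunctor_iff M _).2 hy⟩).2 fun b hb => ?_
    refine (ciInf_le ⟨0, ?_⟩ (b 0)).trans_eq ?_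
    · rintro _ ⟨y, rfl⟩
      exact add_nonneg dist_nonneg
        (mul_nonneg (inv_nonneg.2 hδ.le) (displacement_nonneg _ _ _))
    rw [displacement_eq_zero_of_fixed F ((mem_fixFunctor_iff M b).1 hb), mul_zero, add_zero,
      dist_fin_one]
  · obtain ⟨z, hz, hd⟩ := hF.exists_fixed M y hε
    refine (Metric.infDist_le_dist_of_mem
      (show (fun _ => z) ∈ (fixFunctor.{u} Γ).obj M from (mem_fixFunctor_iff M _).2 hz)).trans ?_
    rw [dist_fin_one]
    linarith [dist_triangle (a 0) y z]

end

end UnitaryRep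

end

theorem mainTheorem4 (Γ : Type v) [Group Γ] [Countable Γ] :
    (UnitaryRep.PropertyT.{u} Γ ↔ (UnitaryRep.fixFunctor.{u} Γ).IsDefinable) ∧
    (UnitaryRep.PropertyT.{u} Γ →
      (∃ (F : Finset Γ) (δ : ℝ), UnitaryRep.IsKazhdanPair.{u} Γ F δ) ∧
      (∀ (F : Finset Γ) (δ : ℝ), UnitaryRep.IsKazhdanPair.{u} Γ F δ →
        (UnitaryRep.fixFunctor.{u} Γ).IsWitness
          ((UnitaryRep.maxMoveFormula F).toTFormula (UnitaryRep.repTheory.{u} Γ))) ∧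
      ∃ ψ : ContLogic.TFormula.{u} (UnitaryRep.repTheory.{u} Γ) 1, ψ.IsSimple ∧
        ∀ (M : ContLogic.Model.{u} (UnitaryRep.repTheory.{u} Γ)) (a : Fin 1 → M.Carrier),
          ψ.interp M a = Metric.infDist a ((UnitaryRep.fixFunctor.{u} Γ).obj M)) := by
  refine ⟨⟨fun hT => ?_, UnitaryRep.propertyT_of_isDefinable⟩, fun hT => ?_⟩
  · obtain ⟨F, δ, hF⟩ := hT.exists_isKazhdanPair
    exact ⟨_, hF.isWitness⟩
  · obtain ⟨F, δ, hF⟩ := hT.exists_isKazhdanPair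
    refine ⟨⟨F, δ, hF⟩, fun F δ hF => hF.isWitness,
      (UnitaryRep.distFixFormula F δ).toTFormula _, ⟨_, rfl⟩, fun M a => ?_⟩
    rw [ContLogic.Formula.interp_toTFormula]
    exact hF.interp_distFixFormula_eq M a
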